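/- Let $\lambda,\mu>0$. For a vector field $u$ on (part of) $\mathbb R^3$ put $\sigma_{ij}(u)=\lambda\,(\operatorname{div}u)\,\delta_{ij}+\mu(\partial_iu_j+\partial_ju_i)$ and $T_vu=\sigma(u)v$ for $v\in\mathbb R^3$. Let $$K_{ij}(x,y)=\frac{1}{8\pi\mu(\lambda+2\mu)}\Big((\lambda+\mu)\,\partial_{x_i}r\,\partial_{x_j}r+(\lambda+3\mu)\,\delta_{ij}\Big)\frac1r,\qquad r=|x-y|,$$ be Kelvin's tensor, and let $G(x,y,v)=(T_{v(y)}K(x,y))^T$, where $T_{v(y)}$ acts in the variable $y$ on each column of $K$. Let $e_1,e_2,e_3$ be the standard basis of $\mathbb R^3$. Let $\Gamma=U\times\{0\}$ with $U\subset\mathbb R^2$ open, and let $g=(g_1,g_2,g_3)\in C_c^\infty(U;\mathbb R^3)$, regarded as a field on $\Gamma$. For a vector field $v$ defined off the plane $\{x_3=0\}$ and $x\in\Gamma$ let $$[v](x)=\lim_{h\to0^+}\big(v(x+he_3)-v(x-he_3)\big).$$ Write $\operatorname{div}_\Gamma g_\Gamma=\partial_1g_1+\partial_2g_2$ and $\nabla_\Gamma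 g_3=(\partial_1g_3,\partial_2g_3,0)$. Then for every $x$ with $x_3\neq0$ the integrals below converge absolutely and the indicated $x_3$-derivatives exist, and at every point of $\Gamma$ the following jumps exist and are given by $$\Big[\int_\Gamma G(x,y,e_3)g(y)\,dy_1dy_2\Big]=g,$$ $$\Big[\int_\Gamma(\partial_{y_1}G)(x,y,e_3)g(y)\,dy_1dy_2\Big]=-\partial_{1}g,$$ $$\Big[\int_\Gamma G(x,y,e_1)g(y)\,dy_1dy_2\Big]=\frac{\lambda}{\lambda+2\mu}g_1e_3+g_3e_1,$$ $$\Big[\int_\Gamma(\partial_{y_3}G)(x,y,e_3)g(y)\,dy_1dy_2\Big]=\frac{\lambda}{\lambda+2\mu}(\operatorname{div}_\Gamma g_\Gamma)e_3+\nabla_\Gamma g_3,$$ $$\Big[\partial_{x_3}\int_\Gamma G(x,y,e_3)g(y)\,dy_1dy_2\Big]=-\frac{\lambda}{\lambda+2\mu}(\operatorname{div}_\Gamma g_\Gamma)e_3-\nabla_\Gamma g_3,$$ $$\begin{aligned}\Big[\partial_{x_3}\int_\Gamma(\partial_{y_3}G)(x,y,e_3)g(y)\,dy_1dy_2\Big]&=\Big(\tfrac{3\lambda+4\mu}{\lambda+2\mu}\partial_1^2g_1+\partial_2^2g_1+2\tfrac{\lambda+\mu}{\lambda+2\mu}\partial_1\partial_2g_2\Big)e_1\\&\quad+\Big(\tfrac{3\lambda+4\mu}{\lambda+2\mu}\partial_2^2g_2+\partial_1^2g_2+2\tfrac{\lambda+\mu}{\lambda+2\mu}\partial_1\partial_2g_1\Big)e_2\\&\quad-\tfrac{\lambda}{\lambda+2\mu}(\partial_1^2+\partial_2^2)g_3\,e_3,\end{aligned}$$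 $$\Big[\partial_{x_3}\int_\Gamma G(x,y,e_1)g(y)\,dy_1dy_2\Big]=\Big(\tfrac{3\lambda+4\mu}{\lambda+2\mu}\partial_1g_1+\partial_2g_2\Big)e_1+\Big(\tfrac{\lambda}{\lambda+2\mu}\partial_2g_1+\partial_1g_2\Big)e_2-\tfrac{\lambda}{\lambda+2\mu}\partial_1g_3\,e_3.$$ -/

import Mathlib

open Filter Topology MeasureTheory
open scoped ContDiff Matrix

namespace ElasticJump

noncomputable section

/-- Euclidean space `ℝ^3`. The coordinates `x_1, x_2, x_3` are `x 0, x 1, x 2`. -/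
abbrev E3 : Type := EuclideanSpace ℝ (Fin 3)

/-- Euclidean plane `ℝ^2`. The coordinates are `y 0, y 1`. -/
abbrev E2 : Type := EuclideanSpace ℝ (Fin 2)

/-- The `i`-th vector of the standard basis of `ℝ^n`; in `ℝ^3` the vectors `e_1, e_2, e_3` are
`stdVec 0, stdVec 1, stdVec 2`. -/
def stdVec {n : ℕ} (i : Fin n) : EuclideanSpace ℝ (Fin n) := EuclideanSpace.single i 1

/-- The partial derivative of `f` at `x` in the `i`-th coordinate. -/
def pd {n : ℕ} {F : Type*} [NormedAddCommGroup F] [NormedSpace ℝ F] (i : Fin n)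
    (f : EuclideanSpace ℝ (Fin n) → F) (x : EuclideanSpace ℝ (Fin n)) : F :=
  lineDeriv ℝ f x (stdVec i)

/-- The point `(y_1, y_2, 0)` of the plane `x_3 = 0`. -/
def toPlane (y : E2) : E3 := !₂[y 0, y 1, 0]

/-- The divergence of a vector field on `ℝ^3`. -/
def divergence (u : E3 → E3) (x : E3) : ℝ := ∑ k : Fin 3, pd k (fun z => u z k) x

/-- The stress tensor
`σ_ij(u) = λ (div u) δ_ij + μ (∂_i u_j + ∂_j u_i)`. -/
def stress (lam mu : ℝ) (u : E3 → E3) (x : E3) : Matrix (Fin 3) (Fin 3) ℝ :=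
  Matrix.of fun i j =>
    lam * divergence u x * (if i = j then 1 else 0)
      + mu * (pd i (fun z => u z j) x + pd j (fun z => u z i) x)

/-- The stress vector `T_v u = σ(u) v` in the direction `v`. -/
def traction (lam mu : ℝ) (v : E3) (u : E3 → E3) (x : E3) : E3 :=
  WithLp.toLp 2 (stress lam mu u x *ᵥ v.ofLp)

/-- Kelvin's Green tensor
`K_ij(x,y) = ((λ + μ) ∂_{x_i} r ∂_{x_j} r + (λ + 3 μ) δ_ij) / (8 π μ (λ + 2 μ) r)`,
`r = |x - y|`. -/
def kelvin (lam mu : ℝ) (x y : E3) : Matrix (Fin 3) (Fin 3) ℝ :=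
  Matrix.of fun i j =>
    1 / (8 * Real.pi * mu * (lam + 2 * mu)) *
      ((lam + mu) * pd i (fun z => ‖z - y‖) x * pd j (fun z => ‖z - y‖) x
        + (lam + 3 * mu) * (if i = j then 1 else 0)) * (1 / ‖x - y‖)

/-- The tensor `G(x,y,v) = (T_{v(y)} K(x,y))ᵀ`: the stress operator acts in the variable `y` on
each column of `K(x, ·)`, and the resulting matrix is transposed. -/
def G (lam mu : ℝ) (x y v : E3) : Matrix (Fin 3) (Fin 3) ℝ :=
  (Matrix.of fun i j =>
    traction lam mu v (fun z => WithLp.toLp 2 (fun k => kelvin lam mu x z k j)) y i)ᵀ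

/-- The entrywise derivative `(∂_{y_k} G)(x,y,v)`. -/
def dyG (lam mu : ℝ) (k : Fin 3) (x y v : E3) : Matrix (Fin 3) (Fin 3) ℝ :=
  Matrix.of fun i j => pd k (fun z => G lam mu x z v i j) y

/-- The integrand `y ↦ M(x, (y_1, y_2, 0)) g(y)` of a surface integral over a subset of the plane
`x_3 = 0`, for a matrix kernel `M` and a density `g`. -/
def layerIntegrand (M : E3 → E3 → Matrix (Fin 3) (Fin 3) ℝ) (g : E2 → E3) (x : E3) (y : E2) : E3 :=
  WithLp.toLp 2 (M x (toPlane y) *ᵥ (g y).ofLp)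

/-- The vector field `x ↦ ∫_Γ M(x,y) g(y) dy_1 dy_2` for the flat surface
`Γ = {(y_1, y_2, 0) : (y_1, y_2) ∈ U}`. -/
def layer (U : Set E2) (M : E3 → E3 → Matrix (Fin 3) (Fin 3) ℝ) (g : E2 → E3) (x : E3) : E3 :=
  ∫ y in U, layerIntegrand M g x y

/-- The field `v` has a jump at the point `x` of the plane `x_3 = 0`, and the jump is `a`:
`lim_{h → 0+} (v(x + h e_3) - v(x - h e_3)) = a`. -/
def HasJump (v : E3 → E3) (x : E3) (a : E3) : Prop :=
  Tendsto (fun h : ℝ => v (x + h • stdVec 2) - v (x - h • stdVec 2)) (𝓝[>] 0) (𝓝 a)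

/-- The surface divergence `∂_1 g_1 + ∂_2 g_2` of the tangential part of `g`. -/
def surfDiv (g : E2 → E3) (x : E2) : ℝ :=
  pd 0 (fun z => g z 0) x + pd 1 (fun z => g z 1) x

/-- The surface gradient `(∂_1 f, ∂_2 f, 0)`. -/
def surfGrad (f : E2 → ℝ) (x : E2) : E3 := !₂[pd 0 f x, pd 1 f x, 0]

end

end ElasticJump

open ElasticJump

namespace ElasticJump

noncomputable section

/-! ### Coordinate derivatives of functions smooth on an open set -/

section PartialDerivatives

variable {n : ℕ} {s : Set (EuclideanSpace ℝ (Fin n))} {f g : EuclideanSpace ℝ (Fin n) → ℝ}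
  {x : EuclideanSpace ℝ (Fin n)}

/-! With `d = x - y`, every kernel in the theorem is a constant-coefficient combination of partial
derivatives of the two radial functions `1 / |d|` and `|d|`. Indeed the Kelvin tensor is a multiple
of `2 (λ + 2μ) δ_ij / |d| - (λ + μ) ∂_i ∂_j |d|` (`kelvin_eq`), and applying the stress operator
gives `stressKernel` (`G_stdVec`, `dyG_stdVec`). So it suffices to know the jump of the scalar
potential of a test density for each derivative of these two functions (`jumpOp_pds`).

Tangential derivatives of the kernel pass to the density by integration by parts (`potential_pd`).
Normal derivatives are removed in pairs: off the plane `Δ (1 / |d|) = 0` and `Δ |d| = 2 / |d|`, so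
`∂_3^2` becomes tangential derivatives plus a simpler kernel (`jumpOp_normal_add_two`). Four base
cases remain. The kernels `1 / |d|` and `|d|` are even in the height and do not jump; `∂_3 |d|` is
bounded and its potential tends to zero at the plane; `∂_3 (1 / |d|)` is `-2π` times the Poisson
kernel above the plane and odd, so it jumps by `-4π f`.

Normal derivatives of the layers are taken under the integral, so they only add an index to the
kernel. The seven formulas are then finite evaluations of `stressJump`. -/

theorem differentiableAt_of_contDiffOn (hs : IsOpen s) (hf : ContDiffOn ℝ ∞ f s) (hx : x ∈ s) :
    DifferentiableAt ℝ f x :=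
  (hf.contDiffAt (hs.mem_nhds hx)).differentiableAt (by simp)

theorem pd_eq_fderiv (hf : DifferentiableAt ℝ f x) (i : Fin n) :
    pd i f x = fderiv ℝ f x (stdVec i) :=
  hf.lineDeriv_eq_fderiv

theorem contDiffOn_pd (hs : IsOpen s) (hf : ContDiffOn ℝ ∞ f s) (i : Fin n) :
    ContDiffOn ℝ ∞ (pd i f) s :=
  ((hf.fderiv_of_isOpen hs (m := ∞) (by simp)).clm_apply contDiffOn_const).congr fun _ hx =>
    pd_eq_fderiv (differentiableAt_of_contDiffOn hs hf hx) i

theorem eqOn_pd (hs : IsOpen s) (h : Set.EqOn f g s) (i : Fin n) :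
    Set.EqOn (pd i f) (pd i g) s := fun _ hx =>
  (h.eventuallyEq_of_mem (hs.mem_nhds hx)).lineDeriv_eq

/-- Both sides are values of the second Fréchet derivative, which is symmetric. -/
theorem eqOn_pd_comm (hs : IsOpen s) (hf : ContDiffOn ℝ ∞ f s) (i j : Fin n) :
    Set.EqOn (pd i (pd j f)) (pd j (pd i f)) s := by
  have key : ∀ i j : Fin n, ∀ x ∈ s,
      pd i (pd j f) x = fderiv ℝ (fderiv ℝ f) x (stdVec i) (stdVec j) := by
    intro i j x hx
    have h2 : DifferentiableAt ℝ (fderiv ℝ f) x :=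
      ((hf.fderiv_of_isOpen hs (m := ∞) (by simp)).contDiffAt
        (hs.mem_nhds hx)).differentiableAt (by simp)
    have e : Set.EqOn (pd j f) (fun y => fderiv ℝ f y (stdVec j)) s := fun y hy =>
      pd_eq_fderiv (differentiableAt_of_contDiffOn hs hf hy) j
    rw [eqOn_pd hs e i hx, pd_eq_fderiv (h2.clm_apply (differentiableAt_const _)),
      fderiv_clm_apply h2 (differentiableAt_const _)]
    simp
  intro x hx
  rw [key i j x hx, key j i x hx]
  exact (hf.contDiffAt (hs.mem_nhds hx)).isSymmSndFDerivAt
    (by simpa using! WithTop.coe_le_coe.2 (le_top : (2 : ℕ∞) ≤ ⊤)) _ _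

theorem pd_add (hf : DifferentiableAt ℝ f x) (hg : DifferentiableAt ℝ g x) (i : Fin n) :
    pd i (fun z => f z + g z) x = pd i f x + pd i g x := by
  rw [pd_eq_fderiv hf, pd_eq_fderiv hg, pd_eq_fderiv (hf.fun_add hg), fderiv_fun_add hf hg]
  rfl

theorem pd_const_mul (c : ℝ) (hf : DifferentiableAt ℝ f x) (i : Fin n) :
    pd i (fun z => c * f z) x = c * pd i f x := by
  rw [pd_eq_fderiv hf, pd_eq_fderiv (hf.const_mul c), fderiv_const_mul hf]
  rfl

theorem pd_comp_sub_left (f : EuclideanSpace ℝ (Fin n) → ℝ) (x y : EuclideanSpace ℝ (Fin n))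
    (i : Fin n) : pd i (fun z => f (x - z)) y = -pd i f (x - y) := by
  unfold pd lineDeriv
  have := deriv_comp_neg (f := fun t : ℝ => f (x - y + t • stdVec i)) 0
  rw [neg_zero] at this
  rw [← this]
  congr 1
  ext t
  dsimp only
  congr 1
  module

theorem pd_comp_sub_right (f : EuclideanSpace ℝ (Fin n) → ℝ) (x y : EuclideanSpace ℝ (Fin n))
    (i : Fin n) : pd i (fun z => f (z - y)) x = pd i f (x - y) := by
  unfold pd lineDeriv
  congr 1
  ext t
  dsimp only
  congr 1
  module

/-- The iterated partial derivative along a list of coordinates, the head being outermost. -/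
def pds (L : List (Fin n)) (k : EuclideanSpace ℝ (Fin n) → ℝ) : EuclideanSpace ℝ (Fin n) → ℝ :=
  L.foldr pd k

theorem contDiffOn_pds (hs : IsOpen s) (hf : ContDiffOn ℝ ∞ f s) (L : List (Fin n)) :
    ContDiffOn ℝ ∞ (pds L f) s := by
  induction L with
  | nil => exact hf
  | cons a L ih => exact contDiffOn_pd hs ih a

theorem eqOn_pds (hs : IsOpen s) (h : Set.EqOn f g s) (L : List (Fin n)) :
    Set.EqOn (pds L f) (pds L g) s := by
  induction L with
  | nil => exact h
  | cons a L ih => exact eqOn_pd hs ih a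

theorem eqOn_pds_perm (hs : IsOpen s) (hf : ContDiffOn ℝ ∞ f s) {L L' : List (Fin n)}
    (h : L.Perm L') : Set.EqOn (pds L f) (pds L' f) s := by
  induction h with
  | nil => exact fun _ _ => rfl
  | cons a _ ih => exact eqOn_pd hs ih a
  | swap a b L => exact eqOn_pd_comm hs (contDiffOn_pds hs hf L) b a
  | trans _ _ ih₁ ih₂ => exact ih₁.trans ih₂

theorem pds_append (L L' : List (Fin n)) (k : EuclideanSpace ℝ (Fin n) → ℝ) :
    pds (L ++ L') k = pds L (pds L' k) :=
  List.foldr_append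

end PartialDerivatives

/-! ### Potentials of test densities over the plane -/

/-- Smooth functions of compact support. -/
structure IsTest {n : ℕ} (f : EuclideanSpace ℝ (Fin n) → ℝ) : Prop where
  smooth : ContDiff ℝ ∞ f
  compact : HasCompactSupport f

theorem tsupport_pd_subset {n : ℕ} {f : EuclideanSpace ℝ (Fin n) → ℝ} (hf : ContDiff ℝ ∞ f)
    (i : Fin n) : tsupport (pd i f) ⊆ tsupport f := by
  have : pd i f = fun x => fderiv ℝ f x (stdVec i) :=
    funext fun x => pd_eq_fderiv (hf.differentiable (by simp) x) i
  rw [this]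
  exact tsupport_fderiv_apply_subset ℝ _

theorem IsTest.pd {n : ℕ} {f : EuclideanSpace ℝ (Fin n) → ℝ} (hf : IsTest f) (i : Fin n) :
    IsTest (pd i f) where
  smooth := contDiffOn_univ.1 (contDiffOn_pd isOpen_univ hf.smooth.contDiffOn i)
  compact := hf.compact.of_isClosed_subset (isClosed_tsupport _) (tsupport_pd_subset hf.smooth i)

theorem IsTest.differentiable {n : ℕ} {f : EuclideanSpace ℝ (Fin n) → ℝ} (hf : IsTest f) :
    Differentiable ℝ f :=
  hf.smooth.differentiable (by simp)

/-- The complement of the plane `x_3 = 0`. -/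
def offPlane : Set E3 := {d | d 2 ≠ 0}

theorem isOpen_offPlane : IsOpen offPlane :=
  isOpen_ne_fun (by fun_prop) continuous_const

theorem ne_zero_of_mem_offPlane {d : E3} (hd : d ∈ offPlane) : d ≠ 0 := by
  rintro rfl
  exact hd rfl

theorem contDiff_toPlane : ContDiff ℝ ∞ toPlane := by
  rw [contDiff_euclidean]
  intro i
  fin_cases i <;> simp [toPlane] <;> fun_prop

theorem toPlane_add_smul (y : E2) (t : ℝ) (a : Fin 2) :
    toPlane (y + t • stdVec a) = toPlane y + t • stdVec a.castSucc := by
  ext i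
  fin_cases a <;> fin_cases i <;> simp [toPlane, stdVec]

theorem sub_toPlane_apply_two (x : E3) (y : E2) : (x - toPlane y) 2 = x 2 := by
  simp [toPlane]

theorem sub_toPlane_mem {x : E3} (hx : x ∈ offPlane) (y : E2) : x - toPlane y ∈ offPlane := by
  have : (x - toPlane y) 2 ≠ 0 := by rwa [sub_toPlane_apply_two]
  exact this

/-- The potential `∫ k(x - y) f(y) dy` over the plane with kernel `k` and density `f`. -/
def potential (k : E3 → ℝ) (f : E2 → ℝ) (x : E3) : ℝ := ∫ y, k (x - toPlane y) * f y

/-- The third coordinate of `x - toPlane y` is `x 2` for all `y`, so the singularity is never met.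
-/
theorem contDiff_kernel {k : E3 → ℝ} (hk : ContDiffOn ℝ ∞ k offPlane) {x : E3}
    (hx : x ∈ offPlane) : ContDiff ℝ ∞ (fun y : E2 => k (x - toPlane y)) :=
  contDiffOn_univ.1 <| hk.comp (contDiff_const.sub contDiff_toPlane).contDiffOn
    fun y _ => sub_toPlane_mem hx y

theorem integrable_kernel_mul {k : E3 → ℝ} (hk : ContDiffOn ℝ ∞ k offPlane) {f : E2 → ℝ}
    (hf : IsTest f) {x : E3} (hx : x ∈ offPlane) :
    Integrable (fun y => k (x - toPlane y) * f y) :=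
  ((contDiff_kernel hk hx).continuous.mul hf.smooth.continuous).integrable_of_hasCompactSupport
    hf.compact.mul_left

theorem potential_congr {k k' : E3 → ℝ} (h : Set.EqOn k k' offPlane) (f : E2 → ℝ) {x : E3}
    (hx : x ∈ offPlane) : potential k f x = potential k' f x := by
  unfold potential
  simp_rw [fun y => h (sub_toPlane_mem hx y)]

theorem pd_kernel {k : E3 → ℝ} (x : E3) (y : E2) (a : Fin 2) :
    pd a (fun y => k (x - toPlane y)) y = -pd a.castSucc k (x - toPlane y) := by
  rw [← pd_comp_sub_left]
  unfold pd lineDeriv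
  simp_rw [toPlane_add_smul]

/-- Integration by parts in the plane; its sign cancels the one from differentiating `x - toPlane y`
in `y`. -/
theorem potential_pd {k : E3 → ℝ} (hk : ContDiffOn ℝ ∞ k offPlane) {f : E2 → ℝ}
    (hf : IsTest f) (a : Fin 2) {x : E3} (hx : x ∈ offPlane) :
    potential (pd a.castSucc k) f x = potential k (pd a f) x := by
  have hd : Differentiable ℝ (fun y : E2 => k (x - toPlane y)) :=
    (contDiff_kernel hk hx).differentiable (by simp)
  have e : ∀ y, fderiv ℝ (fun y : E2 => k (x - toPlane y)) y (stdVec a)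
      = -pd a.castSucc k (x - toPlane y) := fun y => by
    rw [← pd_eq_fderiv (hd y), pd_kernel]
  have e' : ∀ y, fderiv ℝ f y (stdVec a) = pd a f y := fun y =>
    (pd_eq_fderiv (hf.differentiable y) a).symm
  have := integral_mul_fderiv_eq_neg_fderiv_mul_of_integrable (μ := volume) (v := stdVec a)
    (f := fun y : E2 => k (x - toPlane y)) (g := f) ?_ ?_ (integrable_kernel_mul hk hf hx)
    (fun y _ => hd y) (fun y _ => hf.differentiable y)
  · simp_rw [e, e', neg_mul, integral_neg, neg_neg] at this
    exact this.symm
  · simp_rw [e, neg_mul]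
    exact (integrable_kernel_mul (contDiffOn_pd isOpen_offPlane hk _) hf hx).neg
  · simp_rw [e']
    exact integrable_kernel_mul hk (hf.pd a) hx

theorem hasLineDerivAt_potential {k : E3 → ℝ} (hk : ContDiffOn ℝ ∞ k offPlane) {f : E2 → ℝ}
    (hf : IsTest f) {x : E3} (hx : x ∈ offPlane) :
    HasLineDerivAt ℝ (potential k f) (potential (pd 2 k) f x) x (stdVec 2) := by
  have hx' : x 2 ≠ 0 := hx
  have hdk := contDiffOn_pd isOpen_offPlane hk 2
  -- Moving vertically by at most half the height stays off the plane.
  set ε := |x 2| / 2 with hε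
  have hε0 : 0 < ε := half_pos (abs_pos.2 hx')
  have hmem : ∀ t ∈ Metric.closedBall (0 : ℝ) ε, x + t • stdVec 2 ∈ offPlane := by
    intro t ht h0
    rw [mem_closedBall_zero_iff, Real.norm_eq_abs] at ht
    have : x 2 = -t := by
      have : x 2 + t = 0 := by simpa [stdVec] using h0
      linarith
    rw [hε, this, abs_neg] at ht
    have : |t| = 0 := by linarith [abs_nonneg t]
    have : t = 0 := abs_eq_zero.1 this
    simp_all
  obtain ⟨C, hC⟩ := ((isCompact_closedBall (0 : ℝ) ε).prod
    -- A bound uniform in the shift, by compactness; cut off to the support of `f` it is the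
    -- dominating function.
    hf.compact.isCompact).exists_bound_of_continuousOn
      (f := fun p : ℝ × E2 => pd 2 k (x + p.1 • stdVec 2 - toPlane p.2) * f p.2) (by
    refine ContinuousOn.mul (hdk.continuousOn.comp ?_ fun p hp =>
      sub_toPlane_mem (hmem p.1 hp.1) p.2) (hf.smooth.continuous.comp continuous_snd).continuousOn
    have := contDiff_toPlane.continuous
    fun_prop)
  have hb : Integrable ((tsupport f).indicator fun _ => C) volume :=
    (integrable_indicator_iff (isClosed_tsupport f).measurableSet).2
      (integrableOn_const hf.compact.isCompact.measure_lt_top.ne)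
  have main := (hasDerivAt_integral_of_dominated_loc_of_deriv_le (μ := (volume : Measure E2))
    (F := fun (t : ℝ) y => k (x + t • stdVec 2 - toPlane y) * f y)
    (F' := fun (t : ℝ) y => pd 2 k (x + t • stdVec 2 - toPlane y) * f y)
    (x₀ := 0) (Metric.closedBall_mem_nhds 0 hε0) ?_ ?_ ?_ ?_ hb ?_).2
  · simpa [HasLineDerivAt, potential] using main
  · filter_upwards [Metric.closedBall_mem_nhds 0 hε0] with t ht
    exact (integrable_kernel_mul hk hf (hmem t ht)).aestronglyMeasurable
  · exact integrable_kernel_mul hk hf (by simpa using hx)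
  · exact (integrable_kernel_mul hdk hf (by simpa using hx)).aestronglyMeasurable
  · refine ae_of_all _ fun y t ht => ?_
    by_cases hy : y ∈ tsupport f
    · rw [Set.indicator_of_mem hy]
      exact hC (t, y) ⟨ht, hy⟩
    · simp [Set.indicator_of_notMem hy, image_eq_zero_of_notMem_tsupport hy]
  · refine ae_of_all _ fun y t ht => HasDerivAt.mul_const ?_ _
    have hz := sub_toPlane_mem (hmem t ht) y
    have h1 := (differentiableAt_of_contDiffOn isOpen_offPlane hk hz).hasFDerivAt
    have h2 : HasDerivAt (fun t : ℝ => x + t • stdVec 2 - toPlane y) (stdVec 2 : E3) t := by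
      simpa using (((hasDerivAt_id t).smul_const (stdVec 2 : E3)).const_add x).sub_const (toPlane y)
    rw [pd_eq_fderiv (differentiableAt_of_contDiffOn isOpen_offPlane hk hz)]
    exact h1.comp_hasDerivAt t h2

/-! ### Rules for jump operators -/

/-- For every test density `f`, the potential of `f` with kernel `k` jumps by `D f` across the
plane. -/
def JumpOp (k : E3 → ℝ) (D : (E2 → ℝ) → E2 → ℝ) : Prop :=
  ∀ f : E2 → ℝ, IsTest f → ∀ x : E2,
    Tendsto (fun h : ℝ => potential k f (toPlane x + h • stdVec 2)
      - potential k f (toPlane x - h • stdVec 2)) (𝓝[>] 0) (𝓝 (D f x))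

theorem toPlane_add_mem (x : E2) {h : ℝ} (hh : 0 < h) : toPlane x + h • stdVec 2 ∈ offPlane := by
  have : (toPlane x + h • stdVec 2 : E3) 2 ≠ 0 := by simpa [toPlane, stdVec] using hh.ne'
  exact this

theorem toPlane_sub_mem (x : E2) {h : ℝ} (hh : 0 < h) : toPlane x - h • stdVec 2 ∈ offPlane := by
  have : (toPlane x - h • stdVec 2 : E3) 2 ≠ 0 := by simpa [toPlane, stdVec] using hh.ne'
  exact this

variable {k k' : E3 → ℝ} {D D' : (E2 → ℝ) → E2 → ℝ}

theorem JumpOp.congr (H : JumpOp k D) (h : Set.EqOn k' k offPlane) : JumpOp k' D := by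
  intro f hf x
  refine (H f hf x).congr' ?_
  filter_upwards [self_mem_nhdsWithin] with t ht
  rw [potential_congr h f (toPlane_add_mem x ht), potential_congr h f (toPlane_sub_mem x ht)]

theorem potential_add (hk : ContDiffOn ℝ ∞ k offPlane) (hk' : ContDiffOn ℝ ∞ k' offPlane)
    {f : E2 → ℝ} (hf : IsTest f) {x : E3} (hx : x ∈ offPlane) :
    potential (fun d => k d + k' d) f x = potential k f x + potential k' f x := by
  unfold potential
  simp_rw [add_mul]
  exact integral_add (integrable_kernel_mul hk hf hx) (integrable_kernel_mul hk' hf hx)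

theorem potential_const_mul (c : ℝ) (f : E2 → ℝ) (x : E3) :
    potential (fun d => c * k d) f x = c * potential k f x := by
  unfold potential
  simp_rw [mul_assoc]
  exact integral_const_mul _ _

theorem JumpOp.add (H : JumpOp k D) (H' : JumpOp k' D') (hk : ContDiffOn ℝ ∞ k offPlane)
    (hk' : ContDiffOn ℝ ∞ k' offPlane) :
    JumpOp (fun d => k d + k' d) (fun f x => D f x + D' f x) := by
  intro f hf x
  refine ((H f hf x).add (H' f hf x)).congr' ?_
  filter_upwards [self_mem_nhdsWithin] with t ht
  rw [potential_add hk hk' hf (toPlane_add_mem x ht),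
    potential_add hk hk' hf (toPlane_sub_mem x ht)]
  ring

theorem JumpOp.const_mul (H : JumpOp k D) (c : ℝ) :
    JumpOp (fun d => c * k d) (fun f x => c * D f x) := by
  intro f hf x
  refine ((H f hf x).const_mul c).congr fun t => ?_
  rw [potential_const_mul, potential_const_mul]
  ring

theorem JumpOp.pd (H : JumpOp k D) (hk : ContDiffOn ℝ ∞ k offPlane) (a : Fin 2) :
    JumpOp (pd a.castSucc k) (fun f => D (pd a f)) := by
  intro f hf x
  refine (H _ (hf.pd a) x).congr' ?_
  filter_upwards [self_mem_nhdsWithin] with t ht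
  rw [potential_pd hk hf a (toPlane_add_mem x ht), potential_pd hk hf a (toPlane_sub_mem x ht)]

/-- Only `h ^ 2` enters, so radial kernels take equal values at heights `h` and `-h`. -/
theorem norm_toPlane_add_sub (x y : E2) (h : ℝ) :
    ‖toPlane x + h • stdVec 2 - toPlane y‖ = √(h ^ 2 + ‖x - y‖ ^ 2) := by
  rw [EuclideanSpace.norm_eq, EuclideanSpace.norm_sq_eq]
  congr 1
  simp [Fin.sum_univ_three, Fin.sum_univ_two, toPlane, stdVec]
  ring

theorem norm_toPlane_sub_sub (x y : E2) (h : ℝ) :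
    ‖toPlane x - h • stdVec 2 - toPlane y‖ = √(h ^ 2 + ‖x - y‖ ^ 2) := by
  have := norm_toPlane_add_sub x y (-h)
  rwa [neg_smul, ← sub_eq_add_neg, neg_sq] at this

/-- A kernel depending on `|d|` only has no jump. -/
theorem jumpOp_of_norm (φ : ℝ → ℝ) : JumpOp (fun d => φ ‖d‖) 0 := by
  intro f hf x
  simp [potential, norm_toPlane_add_sub, norm_toPlane_sub_sub]

/-! ### Derivatives and Laplacians of the two fundamental solutions -/

/-- The fundamental solution `1 / |d|` of the Laplace equation, up to a factor. -/
def newton (d : E3) : ℝ := 1 / ‖d‖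

/-- The fundamental solution `|d|` of the biharmonic equation, up to a factor. -/
def bih (d : E3) : ℝ := ‖d‖

theorem contDiffOn_bih : ContDiffOn ℝ ∞ bih offPlane := fun _ hd =>
  (contDiffAt_norm ℝ (ne_zero_of_mem_offPlane hd)).contDiffWithinAt

theorem contDiffOn_newton : ContDiffOn ℝ ∞ newton offPlane :=
  contDiffOn_const.div contDiffOn_bih fun _ hd => norm_ne_zero_iff.2 (ne_zero_of_mem_offPlane hd)

theorem hasDerivAt_norm_line {d : E3} (hd : d ≠ 0) (j : Fin 3) :
    HasDerivAt (fun t : ℝ => ‖d + t • stdVec j‖) (d j / ‖d‖) 0 := by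
  have h2 : HasDerivAt (fun t : ℝ => d + t • (stdVec j : E3)) (stdVec j) 0 := by
    simpa using ((hasDerivAt_id (0 : ℝ)).smul_const (stdVec j : E3)).const_add d
  have h3 := h2.norm_sq.sqrt (by simpa using hd)
  simp only [norm_nonneg, Real.sqrt_sq] at h3
  convert! h3 using 1
  simp [stdVec, EuclideanSpace.inner_single_right]
  ring

theorem hasDerivAt_apply_line (d : E3) (j i : Fin 3) :
    HasDerivAt (fun t : ℝ => (d + t • stdVec j : E3) i) (if i = j then 1 else 0) 0 := by
  have := ((hasDerivAt_id (0 : ℝ)).mul_const ((stdVec j : E3) i)).const_add (d i)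
  simpa [stdVec, Pi.single_apply] using this

theorem pd_eq_of_hasDerivAt {f : E3 → ℝ} {d : E3} {j : Fin 3} {a : ℝ}
    (h : HasDerivAt (fun t : ℝ => f (d + t • stdVec j)) a 0) : pd j f d = a :=
  h.deriv

theorem pd_norm {d : E3} (hd : d ≠ 0) (j : Fin 3) : pd j (fun z : E3 => ‖z‖) d = d j / ‖d‖ :=
  pd_eq_of_hasDerivAt (hasDerivAt_norm_line hd j)

theorem eqOn_pd_bih (j : Fin 3) : Set.EqOn (pd j bih) (fun d => d j / ‖d‖) offPlane := fun _ hd =>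
  pd_norm (ne_zero_of_mem_offPlane hd) j

theorem eqOn_pd_pd_bih (i j : Fin 3) : Set.EqOn (pd i (pd j bih))
    (fun d => (if i = j then 1 else 0) / ‖d‖ - d i * d j / ‖d‖ ^ 3) offPlane := by
  intro d hd
  have hd0 := ne_zero_of_mem_offPlane hd
  have hn : ‖d‖ ≠ 0 := norm_ne_zero_iff.2 hd0
  rw [eqOn_pd isOpen_offPlane (eqOn_pd_bih j) i hd]
  refine pd_eq_of_hasDerivAt ?_
  convert! (hasDerivAt_apply_line d i j).div (hasDerivAt_norm_line hd0 i) (by simpa using hd0)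
    using 1
  simp only [zero_smul, add_zero, eq_comm (a := j)]
  field_simp

theorem eqOn_pd_newton (j : Fin 3) :
    Set.EqOn (pd j newton) (fun d => -d j / ‖d‖ ^ 3) offPlane := by
  intro d hd
  have hd0 := ne_zero_of_mem_offPlane hd
  have hn : ‖d‖ ≠ 0 := norm_ne_zero_iff.2 hd0
  refine pd_eq_of_hasDerivAt ?_
  convert! (hasDerivAt_const (0 : ℝ) (1 : ℝ)).div (hasDerivAt_norm_line hd0 j) (by simpa using hd0)
    using 1
  simp only [zero_smul, add_zero]
  field_simp
  ring

theorem eqOn_pd_pd_newton (j : Fin 3) : Set.EqOn (pd j (pd j newton))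
    (fun d => -1 / ‖d‖ ^ 3 + 3 * d j ^ 2 / ‖d‖ ^ 5) offPlane := by
  intro d hd
  have hd0 := ne_zero_of_mem_offPlane hd
  have hn : ‖d‖ ≠ 0 := norm_ne_zero_iff.2 hd0
  rw [eqOn_pd isOpen_offPlane (eqOn_pd_newton j) j hd]
  refine pd_eq_of_hasDerivAt ?_
  convert! (hasDerivAt_apply_line d j j).neg.div ((hasDerivAt_norm_line hd0 j).pow 3)
    (by simpa using hd0) using 1
  simp only [zero_smul, add_zero, if_true, Pi.pow_apply, Pi.neg_apply]
  field_simp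
  push_cast
  ring

theorem norm_sq_eq_sum (d : E3) : ‖d‖ ^ 2 = d 0 ^ 2 + d 1 ^ 2 + d 2 ^ 2 := by
  simp [EuclideanSpace.norm_sq_eq, Fin.sum_univ_three]

/-- `Δ |d| = 2 / |d|`, solved for the normal part to serve as a reduction rule. -/
theorem eqOn_laplacian_bih : Set.EqOn (pd 2 (pd 2 bih))
    (fun d => 2 * newton d + (-1 * pd 0 (pd 0 bih) d + -1 * pd 1 (pd 1 bih) d)) offPlane := by
  intro d hd
  have hn : ‖d‖ ≠ 0 := norm_ne_zero_iff.2 (ne_zero_of_mem_offPlane hd)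
  dsimp only
  rw [eqOn_pd_pd_bih 0 0 hd, eqOn_pd_pd_bih 1 1 hd, eqOn_pd_pd_bih 2 2 hd, newton]
  simp only [if_true]
  field_simp
  linear_combination norm_sq_eq_sum d

theorem eqOn_laplacian_newton : Set.EqOn (pd 2 (pd 2 newton))
    (fun d => -1 * pd 0 (pd 0 newton) d + -1 * pd 1 (pd 1 newton) d) offPlane := by
  intro d hd
  have hn : ‖d‖ ≠ 0 := norm_ne_zero_iff.2 (ne_zero_of_mem_offPlane hd)
  dsimp only
  rw [eqOn_pd_pd_newton 0 hd, eqOn_pd_pd_newton 1 hd, eqOn_pd_pd_newton 2 hd]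
  field_simp
  linear_combination -3 * norm_sq_eq_sum d

/-! ### Base jumps -/

theorem jumpOp_bih : JumpOp bih 0 := jumpOp_of_norm fun r => r

theorem jumpOp_newton : JumpOp newton 0 := jumpOp_of_norm fun r => 1 / r

theorem sq_add_norm_sq_pos {h : ℝ} (hh : 0 < h) (y : E2) : 0 < h ^ 2 + ‖y‖ ^ 2 := by positivity

theorem apply_two_add (x y : E2) (h : ℝ) : (toPlane x + h • stdVec 2 - toPlane y : E3) 2 = h := by
  simp [toPlane, stdVec]

theorem apply_two_sub (x y : E2) (h : ℝ) : (toPlane x - h • stdVec 2 - toPlane y : E3) 2 = -h := by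
  simp [toPlane, stdVec]

/-- The kernel `d_3 / |d|` is odd in `d_3`, so the jump is twice the limit from above. That limit is
zero by dominated convergence: the kernel is at most one in modulus and vanishes as `h → 0` except
at `y = x`. -/
theorem jumpOp_pd_two_bih : JumpOp (pd 2 bih) 0 := by
  refine JumpOp.congr (k := fun d => d 2 / ‖d‖) ?_ (eqOn_pd_bih 2)
  intro f hf x
  have key : Tendsto (fun h : ℝ => ∫ y, h / √(h ^ 2 + ‖x - y‖ ^ 2) * f y) (𝓝[>] 0)
      (𝓝 (∫ _ : E2, (0 : ℝ))) := by
    refine tendsto_integral_filter_of_dominated_convergence (fun y => ‖f y‖) ?_ ?_ ?_ ?_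
    · filter_upwards [self_mem_nhdsWithin] with h hh
      have hc : Continuous fun y => h / √(h ^ 2 + ‖x - y‖ ^ 2) * f y := by
        refine (continuous_const.div (by fun_prop) fun y => ?_).mul hf.smooth.continuous
        exact (Real.sqrt_pos.2 (sq_add_norm_sq_pos hh _)).ne'
      exact hc.aestronglyMeasurable
    · filter_upwards [self_mem_nhdsWithin] with h hh
      refine ae_of_all _ fun y => ?_
      have hh' : 0 < h := hh
      rw [norm_mul]
      refine mul_le_of_le_one_left (norm_nonneg _) ?_
      rw [Real.norm_of_nonneg (by positivity)]
      refine div_le_one_of_le₀ (Real.le_sqrt_of_sq_le ?_) (Real.sqrt_nonneg _)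
      nlinarith [sq_nonneg ‖x - y‖]
    · exact (hf.smooth.continuous.integrable_of_hasCompactSupport hf.compact).norm
    · filter_upwards [compl_mem_ae_iff.2 (measure_singleton (μ := (volume : Measure E2)) x)]
        with y hy
      have hxy : x - y ≠ 0 := sub_ne_zero.2 fun h => hy h.symm
      have hc : ContinuousAt (fun h : ℝ => h / √(h ^ 2 + ‖x - y‖ ^ 2) * f y) 0 := by
        refine ContinuousAt.mul (continuousAt_id.div (by fun_prop) ?_) continuousAt_const
        simpa using hxy
      simpa using hc.tendsto.mono_left nhdsWithin_le_nhds
  rw [integral_zero] at key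
  have := key.const_mul 2
  rw [mul_zero] at this
  refine this.congr fun h => ?_
  simp only [potential, norm_toPlane_add_sub, norm_toPlane_sub_sub, apply_two_add, apply_two_sub,
    neg_div, neg_mul, integral_neg]
  ring

theorem integral_Ioi_poisson : ∫ t in Set.Ioi (0 : ℝ), t * (1 / √(1 + t ^ 2) ^ 3) = 1 := by
  have hpos : ∀ t : ℝ, 0 < 1 + t ^ 2 := fun t => by positivity
  have hd : ∀ t : ℝ, HasDerivAt (fun t => -(1 / √(1 + t ^ 2))) (t * (1 / √(1 + t ^ 2) ^ 3)) t := by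
    intro t
    have h1 := (((hasDerivAt_id t).pow 2).const_add 1).sqrt (by simpa using (hpos t).ne')
    have hs : √(1 + t ^ 2) ≠ 0 := (Real.sqrt_pos.2 (hpos t)).ne'
    convert! ((hasDerivAt_const t (1 : ℝ)).div h1 (by simpa using hs)).neg using 1
    simp only [Pi.pow_apply, id]
    field_simp
    ring
  have ht : Tendsto (fun t : ℝ => -(1 / √(1 + t ^ 2))) atTop (𝓝 0) := by
    have : Tendsto (fun t : ℝ => √(1 + t ^ 2)) atTop atTop :=
      Real.tendsto_sqrt_atTop.comp
        (tendsto_atTop_add_const_left _ _ (tendsto_pow_atTop two_ne_zero))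
    simpa using this.inv_tendsto_atTop.neg
  have := integral_Ioi_of_hasDerivAt_of_nonneg' (a := 0) (fun t _ => hd t)
    (fun t ht => mul_nonneg (le_of_lt ht) (by positivity)) ht
  simpa using this

/-- The Poisson kernel of the half space at height one. -/
def poisson (z : E2) : ℝ := 1 / (2 * Real.pi) * (1 / √(1 + ‖z‖ ^ 2) ^ 3)

/-- Polar coordinates: the factor `2π` is the dimension times the area of the unit disc. -/
theorem integral_poisson : ∫ z, poisson z = 1 := by
  unfold poisson
  have h := integral_fun_norm_addHaar (volume : Measure E2) (fun t => 1 / √(1 + t ^ 2) ^ 3)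
  have hb : (volume : Measure E2).real (Metric.ball 0 1) = Real.pi := by
    simp [Measure.real, Real.pi_nonneg]
  rw [integral_const_mul, h, hb]
  simp only [finrank_euclideanSpace, Fintype.card_fin, Nat.add_one_sub_one, pow_one, smul_eq_mul,
    integral_Ioi_poisson]
  have := Real.pi_ne_zero
  simp
  field_simp

/-- The decay condition for an approximate identity in dimension 2. -/
theorem tendsto_poisson : Tendsto (fun z : E2 => ‖z‖ ^ 2 * poisson z) (Bornology.cobounded E2)
    (𝓝 0) := by
  have h : Tendsto (fun z : E2 => 1 / (2 * Real.pi) * ‖z‖⁻¹) (Bornology.cobounded E2) (𝓝 0) := by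
    simpa using (tendsto_norm_cobounded_atTop (E := E2)).inv_tendsto_atTop.const_mul
      (1 / (2 * Real.pi))
  refine squeeze_zero (fun z => by unfold poisson; positivity) (fun z => ?_) h
  unfold poisson
  have hz : ‖z‖ ≤ √(1 + ‖z‖ ^ 2) := Real.le_sqrt_of_sq_le (by linarith)
  rw [mul_left_comm]
  refine mul_le_mul_of_nonneg_left ?_ (by positivity)
  rcases eq_or_ne z 0 with rfl | h0
  · simp
  have hz0 : 0 < ‖z‖ := norm_pos_iff.2 h0
  calc ‖z‖ ^ 2 * (1 / √(1 + ‖z‖ ^ 2) ^ 3) ≤ ‖z‖ ^ 2 * (1 / ‖z‖ ^ 3) := by gcongr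
    _ = ‖z‖⁻¹ := by field_simp

theorem scaled_poisson {h : ℝ} (hh : 0 < h) (z : E2) :
    h⁻¹ ^ 2 * poisson (h⁻¹ • z) = 1 / (2 * Real.pi) * (h / √(h ^ 2 + ‖z‖ ^ 2) ^ 3) := by
  have e : √(1 + ‖h⁻¹ • z‖ ^ 2) = √(h ^ 2 + ‖z‖ ^ 2) / h := by
    rw [norm_smul, Real.norm_of_nonneg (inv_nonneg.2 hh.le), ← Real.sqrt_sq hh.le,
      ← Real.sqrt_div' _ (by positivity), Real.sqrt_sq hh.le]
    congr 1
    field_simp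
  have := (Real.sqrt_pos.2 (sq_add_norm_sq_pos hh z)).ne'
  rw [poisson, e]
  field_simp

/-- At height `h` the kernel is `-2π` times the Poisson kernel rescaled by `h`, an approximate
identity. Oddness in the height doubles the limit. -/
theorem jumpOp_pd_two_newton : JumpOp (pd 2 newton) (fun f x => -4 * Real.pi * f x) := by
  refine JumpOp.congr (k := fun d => -d 2 / ‖d‖ ^ 3) ?_ (eqOn_pd_newton 2)
  intro f hf x
  have key := tendsto_integral_comp_smul_smul_of_integrable' (μ := (volume : Measure E2))
    (φ := poisson) (fun z => by unfold poisson; positivity) integral_poisson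
    (by simpa using tendsto_poisson)
    (hf.smooth.continuous.integrable_of_hasCompactSupport hf.compact)
    (hf.smooth.continuous.continuousAt (x := x))
  refine ((key.comp tendsto_inv_nhdsGT_zero).const_mul (-4 * Real.pi)).congr' ?_
  filter_upwards [self_mem_nhdsWithin] with h hh
  have hp := Real.pi_ne_zero
  simp only [Function.comp, finrank_euclideanSpace, Fintype.card_fin, scaled_poisson hh,
    smul_eq_mul, mul_assoc, integral_const_mul]
  simp only [potential, norm_toPlane_add_sub, norm_toPlane_sub_sub, apply_two_add, apply_two_sub,
    neg_div, neg_mul, neg_neg, integral_neg]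
  field_simp
  ring

/-! ### Jumps of all derivatives of the fundamental solutions -/

section Linearity

variable {n : ℕ} {s : Set (EuclideanSpace ℝ (Fin n))} {f g : EuclideanSpace ℝ (Fin n) → ℝ}

theorem eqOn_pds_add (hs : IsOpen s) (hf : ContDiffOn ℝ ∞ f s) (hg : ContDiffOn ℝ ∞ g s)
    (L : List (Fin n)) :
    Set.EqOn (pds L fun z => f z + g z) (fun z => pds L f z + pds L g z) s := by
  induction L with
  | nil => exact fun _ _ => rfl
  | cons a L ih =>
    exact fun x hx => (eqOn_pd hs ih a hx).trans <|
      pd_add (differentiableAt_of_contDiffOn hs (contDiffOn_pds hs hf L) hx)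
        (differentiableAt_of_contDiffOn hs (contDiffOn_pds hs hg L) hx) a

theorem eqOn_pds_const_mul (hs : IsOpen s) (c : ℝ) (hf : ContDiffOn ℝ ∞ f s) (L : List (Fin n)) :
    Set.EqOn (pds L fun z => c * f z) (fun z => c * pds L f z) s := by
  induction L with
  | nil => exact fun _ _ => rfl
  | cons a L ih =>
    exact fun x hx => (eqOn_pd hs ih a hx).trans <|
      pd_const_mul c (differentiableAt_of_contDiffOn hs (contDiffOn_pds hs hf L) hx) a

end Linearity

/-- Jump relations for repeated normal derivatives of a kernel whose Laplacian is `c • k₀`. -/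
theorem jumpOp_normal_add_two {k k₀ : E3 → ℝ} {D D₀ : (E2 → ℝ) → E2 → ℝ} {c : ℝ}
    (hk : ContDiffOn ℝ ∞ k offPlane) (hk₀ : ContDiffOn ℝ ∞ k₀ offPlane)
    (h : Set.EqOn (pd 2 (pd 2 k))
      (fun d => c * k₀ d + (-1 * pd 0 (pd 0 k) d + -1 * pd 1 (pd 1 k) d)) offPlane) (n : ℕ)
    (H₀ : JumpOp (pds (List.replicate n 2) k₀) D₀) (H : JumpOp (pds (List.replicate n 2) k) D) :
    JumpOp (pds (List.replicate (n + 2) 2) k)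
      (fun f x => c * D₀ f x + (-1 * D (pd 0 (pd 0 f)) x + -1 * D (pd 1 (pd 1 f)) x)) := by
  set R : List (Fin 3) := List.replicate n 2 with hR
  have ho := isOpen_offPlane
  have sm : ∀ L, ContDiffOn ℝ ∞ (pds L k) offPlane := contDiffOn_pds ho hk
  have h0 : JumpOp (pds ([0, 0] ++ R) k) (fun f => D (pd 0 (pd 0 f))) :=
    (H.pd (sm R) 0).pd (sm (0 :: R)) 0
  have h1 : JumpOp (pds ([1, 1] ++ R) k) (fun f => D (pd 1 (pd 1 f))) :=
    (H.pd (sm R) 1).pd (sm (1 :: R)) 1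
  refine ((H₀.const_mul c).add ((h0.const_mul (-1)).add (h1.const_mul (-1))
    (contDiffOn_const.mul (sm _)) (contDiffOn_const.mul (sm _)))
    (contDiffOn_const.mul (contDiffOn_pds ho hk₀ R))
    ((contDiffOn_const.mul (sm _)).add (contDiffOn_const.mul (sm _)))).congr ?_
  intro d hd
  have e2 : pds (List.replicate (n + 2) 2) k = pds R (pd 2 (pd 2 k)) := by
    rw [List.replicate_add, pds_append]
    rfl
  have s0 : ContDiffOn ℝ ∞ (pd 0 (pd 0 k)) offPlane := sm [0, 0]
  have s1 : ContDiffOn ℝ ∞ (pd 1 (pd 1 k)) offPlane := sm [1, 1]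
  rw [e2, eqOn_pds ho h R hd,
    eqOn_pds_add ho (contDiffOn_const.mul hk₀)
      ((contDiffOn_const.mul s0).add (contDiffOn_const.mul s1)) R hd]
  dsimp only
  rw [eqOn_pds_add ho (contDiffOn_const.mul s0) (contDiffOn_const.mul s1) R hd]
  dsimp only
  rw [eqOn_pds_const_mul ho c hk₀ R hd, eqOn_pds_const_mul ho (-1) s0 R hd,
    eqOn_pds_const_mul ho (-1) s1 R hd, eqOn_pds_perm ho hk (List.perm_append_comm) hd,
    eqOn_pds_perm ho hk (List.perm_append_comm (l₁ := [1, 1])) hd, pds_append, pds_append]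
  rfl

/-- The jump of the potential with kernel `∂_3^n (1 / |d|)`. -/
def newtonJump : ℕ → (E2 → ℝ) → E2 → ℝ
  | 0 => 0
  | 1 => fun f x => -4 * Real.pi * f x
  -- The zero term gives the shape of `jumpOp_normal_add_two` with `c = 0`.
  | n + 2 => fun f x => 0 * newtonJump n f x +
      (-1 * newtonJump n (pd 0 (pd 0 f)) x + -1 * newtonJump n (pd 1 (pd 1 f)) x)

/-- The jump of the potential with kernel `∂_3^n |d|`. -/
def bihJump : ℕ → (E2 → ℝ) → E2 → ℝ
  | 0 => 0
  | 1 => 0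
  | n + 2 => fun f x => 2 * newtonJump n f x +
      (-1 * bihJump n (pd 0 (pd 0 f)) x + -1 * bihJump n (pd 1 (pd 1 f)) x)

theorem jumpOp_normal_newton : ∀ n, JumpOp (pds (List.replicate n 2) newton) (newtonJump n)
  | 0 => jumpOp_newton
  | 1 => jumpOp_pd_two_newton
  | n + 2 => jumpOp_normal_add_two contDiffOn_newton contDiffOn_newton
      (by simpa using eqOn_laplacian_newton) n (jumpOp_normal_newton n) (jumpOp_normal_newton n)

theorem jumpOp_normal_bih : ∀ n, JumpOp (pds (List.replicate n 2) bih) (bihJump n)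
  | 0 => jumpOp_bih
  | 1 => jumpOp_pd_two_bih
  | n + 2 => jumpOp_normal_add_two contDiffOn_bih contDiffOn_newton
      eqOn_laplacian_bih n (jumpOp_normal_newton n) (jumpOp_normal_bih n)

/-- The tangential derivatives occurring in a list of coordinates of `ℝ^3`. -/
def tangential : List (Fin 3) → (E2 → ℝ) → E2 → ℝ
  | [], f => f
  -- The head hits `f` first, since `JumpOp.pd` precomposes the jump operator with a derivative.
  | a :: L, f => tangential L (if a = 0 then pd 0 f else if a = 1 then pd 1 f else f)

/-- The count `n` is general so that the induction can move each normal index of `L` into the block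
on the right. -/
theorem jumpOp_pds_append {k : E3 → ℝ} (hk : ContDiffOn ℝ ∞ k offPlane)
    {J : ℕ → (E2 → ℝ) → E2 → ℝ} (H : ∀ n, JumpOp (pds (List.replicate n 2) k) (J n))
    (L : List (Fin 3)) : ∀ n, JumpOp (pds (L ++ List.replicate n 2) k)
      (fun f => J (L.count 2 + n) (tangential L f)) := by
  induction L with
  | nil => intro n; simpa [tangential] using H n
  | cons a L ih =>
    intro n
    have sm := contDiffOn_pds isOpen_offPlane hk (L ++ List.replicate n 2)
    fin_cases a
    · simpa [tangential] using! (ih n).pd sm 0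
    · simpa [tangential] using! (ih n).pd sm 1
    · have := (ih (n + 1)).congr (k' := pds (2 :: L ++ List.replicate n 2) k)
        (eqOn_pds_perm isOpen_offPlane hk
          (by simpa [List.replicate_succ] using List.perm_middle.symm))
      simpa [tangential, add_assoc, add_comm 1 n] using! this

theorem jumpOp_pds {k : E3 → ℝ} (hk : ContDiffOn ℝ ∞ k offPlane)
    {J : ℕ → (E2 → ℝ) → E2 → ℝ} (H : ∀ n, JumpOp (pds (List.replicate n 2) k) (J n))
    (L : List (Fin 3)) : JumpOp (pds L k) (fun f => J (L.count 2) (tangential L f)) := by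
  simpa using jumpOp_pds_append hk H L 0

/-! ### The stress kernel and its jump -/

/-- The Kronecker symbol. -/
def delta (i j : Fin 3) : ℝ := if i = j then 1 else 0

/-- The derivative along `L` of the stress of the Kelvin tensor in terms of derivatives of the
fundamental solutions: the entry `(i, j)` of `∂^L G(x, y, e_l)` as a function of `d = x - y`. -/
def stressKernel (lam mu : ℝ) (L : List (Fin 3)) (l i j : Fin 3) (d : E3) : ℝ :=
  -1 / (4 * Real.pi * (lam + 2 * mu)) *
    (lam * delta j l * pds (L ++ [i]) newton d
      + ((lam + 2 * mu) * delta i l * pds (L ++ [j]) newton d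
      + ((lam + 2 * mu) * delta i j * pds (L ++ [l]) newton d
      + -(lam + mu) * pds (L ++ [i, j, l]) bih d)))

/-- The jump belonging to `stressKernel`. -/
def stressJump (lam mu : ℝ) (L : List (Fin 3)) (l i j : Fin 3) (f : E2 → ℝ) (x : E2) : ℝ :=
  -1 / (4 * Real.pi * (lam + 2 * mu)) *
    (lam * delta j l * newtonJump ((L ++ [i]).count 2) (tangential (L ++ [i]) f) x
      + ((lam + 2 * mu) * delta i l * newtonJump ((L ++ [j]).count 2) (tangential (L ++ [j]) f) x
      + ((lam + 2 * mu) * delta i j * newtonJump ((L ++ [l]).count 2) (tangential (L ++ [l]) f) x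
      + -(lam + mu) * bihJump ((L ++ [i, j, l]).count 2) (tangential (L ++ [i, j, l]) f) x)))

theorem contDiffOn_pds_newton (L : List (Fin 3)) : ContDiffOn ℝ ∞ (pds L newton) offPlane :=
  contDiffOn_pds isOpen_offPlane contDiffOn_newton L

theorem contDiffOn_pds_bih (L : List (Fin 3)) : ContDiffOn ℝ ∞ (pds L bih) offPlane :=
  contDiffOn_pds isOpen_offPlane contDiffOn_bih L

variable (lam mu : ℝ) (L : List (Fin 3)) (l i j : Fin 3)

theorem contDiffOn_stressKernel : ContDiffOn ℝ ∞ (stressKernel lam mu L l i j) offPlane :=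
  contDiffOn_const.mul <| (contDiffOn_const.mul (contDiffOn_pds_newton _)).add <|
    (contDiffOn_const.mul (contDiffOn_pds_newton _)).add <|
    (contDiffOn_const.mul (contDiffOn_pds_newton _)).add <|
    contDiffOn_const.mul (contDiffOn_pds_bih _)

theorem jumpOp_stressKernel :
    JumpOp (stressKernel lam mu L l i j) (stressJump lam mu L l i j) := by
  have hN := fun c L => contDiffOn_const (c := (c : ℝ)).mul (contDiffOn_pds_newton L)
  have hB := fun c L => contDiffOn_const (c := (c : ℝ)).mul (contDiffOn_pds_bih L)
  have jN := fun (c : ℝ) L => (jumpOp_pds contDiffOn_newton jumpOp_normal_newton L).const_mul c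
  have jB := fun (c : ℝ) L => (jumpOp_pds contDiffOn_bih jumpOp_normal_bih L).const_mul c
  exact ((jN _ _).add ((jN _ _).add ((jN _ _).add (jB _ _) (hN _ _) (hB _ _)) (hN _ _)
    ((hN _ _).add (hB _ _))) (hN _ _) ((hN _ _).add ((hN _ _).add (hB _ _)))).const_mul _

theorem eqOn_pd_stressKernel (a : Fin 3) : Set.EqOn (pd a (stressKernel lam mu L l i j))
    (stressKernel lam mu (a :: L) l i j) offPlane := by
  intro d hd
  have dN := fun (c : ℝ) L => (differentiableAt_of_contDiffOn isOpen_offPlane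
    (contDiffOn_pds_newton L) hd).const_mul c
  have dB := fun (c : ℝ) L => (differentiableAt_of_contDiffOn isOpen_offPlane
    (contDiffOn_pds_bih L) hd).const_mul c
  have eN := fun (c : ℝ) L => pd_const_mul c (differentiableAt_of_contDiffOn isOpen_offPlane
    (contDiffOn_pds_newton L) hd) a
  have eB := fun (c : ℝ) L => pd_const_mul c (differentiableAt_of_contDiffOn isOpen_offPlane
    (contDiffOn_pds_bih L) hd) a
  unfold stressKernel
  rw [pd_const_mul _ ((dN _ _).fun_add ((dN _ _).fun_add ((dN _ _).fun_add (dB _ _)))),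
    pd_add (dN _ _) ((dN _ _).fun_add ((dN _ _).fun_add (dB _ _))),
    pd_add (dN _ _) ((dN _ _).fun_add (dB _ _)), pd_add (dN _ _) (dB _ _), eN, eN, eN, eB]
  rfl

/-! ### Reduction of Kelvin's tensor and its stress to the fundamental solutions -/

/-- The Kelvin tensor as a function of `d = x - y`, in terms of the fundamental solutions. -/
def kelvinKernel (lam mu : ℝ) (i j : Fin 3) (d : E3) : ℝ :=
  1 / (8 * Real.pi * mu * (lam + 2 * mu)) *
    (2 * (lam + 2 * mu) * delta i j * newton d + -(lam + mu) * pd i (pd j bih) d)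

theorem kelvin_eq (lam mu : ℝ) {x y : E3} (h : x - y ∈ offPlane) (i j : Fin 3) :
    kelvin lam mu x y i j = kelvinKernel lam mu i j (x - y) := by
  have hd0 := ne_zero_of_mem_offPlane h
  have hn : ‖x - y‖ ≠ 0 := norm_ne_zero_iff.2 hd0
  unfold kelvin kelvinKernel
  rw [Matrix.of_apply, eqOn_pd_pd_bih i j h, newton, delta,
    pd_comp_sub_right (fun z : E3 => ‖z‖), pd_comp_sub_right (fun z : E3 => ‖z‖), pd_norm hd0,
    pd_norm hd0, mul_assoc]
  congr 1
  field_simp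
  ring

theorem pd_kelvinKernel (lam mu : ℝ) (a i j : Fin 3) {d : E3} (hd : d ∈ offPlane) :
    pd a (kelvinKernel lam mu i j) d = 1 / (8 * Real.pi * mu * (lam + 2 * mu)) *
      (2 * (lam + 2 * mu) * delta i j * pd a newton d
        + -(lam + mu) * pd a (pd i (pd j bih)) d) := by
  have dN := differentiableAt_of_contDiffOn isOpen_offPlane contDiffOn_newton hd
  have dB : DifferentiableAt ℝ (pd i (pd j bih)) d :=
    differentiableAt_of_contDiffOn isOpen_offPlane (contDiffOn_pds_bih [i, j]) hd
  unfold kelvinKernel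
  rw [pd_const_mul _ ((dN.const_mul _).fun_add (dB.const_mul _)),
    pd_add (dN.const_mul _) (dB.const_mul _), pd_const_mul _ dN]
  rw [pd_const_mul _ dB]

theorem pd_kelvin (lam mu : ℝ) {x y : E3} (h : x - y ∈ offPlane) (a i j : Fin 3) :
    pd a (fun z => kelvin lam mu x z i j) y = -pd a (kelvinKernel lam mu i j) (x - y) := by
  rw [← pd_comp_sub_left]
  have ho : IsOpen {z : E3 | x - z ∈ offPlane} :=
    isOpen_offPlane.preimage (continuous_const.sub continuous_id)
  exact eqOn_pd ho (fun z hz => kelvin_eq lam mu hz i j) a h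

theorem sum_pd_pd_bih (i : Fin 3) {d : E3} (hd : d ∈ offPlane) :
    pd 0 (pd 0 (pd i bih)) d + pd 1 (pd 1 (pd i bih)) d + pd 2 (pd 2 (pd i bih)) d
      = 2 * pd i newton d := by
  have ho := isOpen_offPlane
  have comm : ∀ a : Fin 3, pd a (pd a (pd i bih)) d = pd i (pd a (pd a bih)) d := fun a =>
    eqOn_pds_perm (L := [a, a, i]) (L' := [i, a, a]) ho contDiffOn_bih
      (List.perm_append_comm (l₁ := [a, a]) (l₂ := [i])) hd
  have dN := differentiableAt_of_contDiffOn ho contDiffOn_newton hd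
  have dB : ∀ a : Fin 3, DifferentiableAt ℝ (pd a (pd a bih)) d := fun a =>
    differentiableAt_of_contDiffOn ho (contDiffOn_pds_bih [a, a]) hd
  have := eqOn_pd ho eqOn_laplacian_bih i hd
  rw [pd_add (dN.const_mul _) (((dB 0).const_mul _).fun_add ((dB 1).const_mul _)),
    pd_add ((dB 0).const_mul _) ((dB 1).const_mul _), pd_const_mul _ dN, pd_const_mul _ (dB 0),
    pd_const_mul _ (dB 1)] at this
  rw [comm, comm, comm, this]
  ring

/-- Contraction gives `2 (λ + 2μ) ∂_i (1 / |d|)` from the Kronecker term and, by `sum_pd_pd_bih`,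
`-2 (λ + μ) ∂_i (1 / |d|)` from the Hessian term. The sum `2μ` cancels the `μ` in the prefactor. -/
theorem divergence_kelvinKernel {lam mu : ℝ} (hlam : 0 < lam) (hmu : 0 < mu) (i : Fin 3) {d : E3}
    (hd : d ∈ offPlane) : ∑ k, pd k (kelvinKernel lam mu k i) d
      = 1 / (4 * Real.pi * (lam + 2 * mu)) * pd i newton d := by
  have hp := Real.pi_pos
  have h2 : lam + 2 * mu ≠ 0 := by positivity
  have hs : ∑ k, delta k i * pd k newton d = pd i newton d := by simp [delta]
  rw [Fin.sum_univ_three] at hs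
  simp_rw [Fin.sum_univ_three, pd_kelvinKernel lam mu _ _ _ hd]
  have hl := sum_pd_pd_bih i hd
  field_simp
  linear_combination 8 * (lam + 2 * mu) * hs - 4 * (lam + mu) * hl

/-- The overall minus sign is `∂_y = -∂_x`. Both shear terms contain the same third derivative of
`|d|`, which accounts for the factor `4π` in place of `8π`. -/
theorem G_stdVec {lam mu : ℝ} (hlam : 0 < lam) (hmu : 0 < mu) (l i j : Fin 3) {x y : E3}
    (h : x - y ∈ offPlane) :
    G lam mu x y (stdVec l) i j = stressKernel lam mu [] l i j (x - y) := by
  have hp := Real.pi_pos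
  have h2 : lam + 2 * mu ≠ 0 := by positivity
  have e1 : G lam mu x y (stdVec l) i j
      = lam * (-∑ k, pd k (kelvinKernel lam mu k i) (x - y)) * (if j = l then 1 else 0)
      + mu * (-pd j (kelvinKernel lam mu l i) (x - y)
        + -pd l (kelvinKernel lam mu j i) (x - y)) := by
    simp [G, traction, stress, divergence, stdVec, pd_kelvin lam mu h]
  have c1 : pd j (pd l (pd i bih)) (x - y) = pd i (pd j (pd l bih)) (x - y) :=
    eqOn_pds_perm (L := [j, l, i]) (L' := [i, j, l]) isOpen_offPlane contDiffOn_bih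
      (List.perm_append_comm (l₁ := [j, l]) (l₂ := [i])) h
  have c2 : pd l (pd j (pd i bih)) (x - y) = pd i (pd j (pd l bih)) (x - y) :=
    eqOn_pds_perm (L := [l, j, i]) (L' := [i, j, l]) isOpen_offPlane contDiffOn_bih
      (List.reverse_perm [i, j, l]) h
  rw [e1, divergence_kelvinKernel hlam hmu i h, pd_kelvinKernel _ _ _ _ _ h,
    pd_kelvinKernel _ _ _ _ _ h, c1, c2]
  simp only [stressKernel, pds, List.nil_append, List.foldr, delta, eq_comm (a := l) (b := i),
    eq_comm (a := j) (b := i)]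
  field_simp
  ring

theorem dyG_stdVec {lam mu : ℝ} (hlam : 0 < lam) (hmu : 0 < mu) (k l i j : Fin 3) {x y : E3}
    (h : x - y ∈ offPlane) :
    dyG lam mu k x y (stdVec l) i j = -1 * stressKernel lam mu [k] l i j (x - y) := by
  have ho : IsOpen {z : E3 | x - z ∈ offPlane} :=
    isOpen_offPlane.preimage (continuous_const.sub continuous_id)
  rw [← eqOn_pd_stressKernel lam mu [] l i j k h, neg_one_mul, ← pd_comp_sub_left]
  exact eqOn_pd ho (fun z hz => G_stdVec hlam hmu l i j hz) k h

/-! ### Vector layers in terms of scalar potentials -/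

section Layer

variable {U : Set E2} {M : E3 → E3 → Matrix (Fin 3) (Fin 3) ℝ} {S : Fin 3 → Fin 3 → E3 → ℝ}
  {g : E2 → E3}

theorem layerIntegrand_apply
    (hM : ∀ x y, x - y ∈ offPlane → ∀ i j, M x y i j = S i j (x - y))
    {x : E3} (hx : x ∈ offPlane) (y : E2) (i : Fin 3) :
    layerIntegrand M g x y i = ∑ j, S i j (x - toPlane y) * g y j := by
  simp [layerIntegrand, Matrix.mulVec, dotProduct, hM _ _ (sub_toPlane_mem hx y)]

theorem integrable_layerIntegrand_apply
    (hM : ∀ x y, x - y ∈ offPlane → ∀ i j, M x y i j = S i j (x - y))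
    (hS : ∀ i j, ContDiffOn ℝ ∞ (S i j) offPlane) (hg : ∀ j, IsTest fun y => g y j)
    {x : E3} (hx : x ∈ offPlane) (i : Fin 3) :
    Integrable fun y => layerIntegrand M g x y i := by
  simp_rw [layerIntegrand_apply hM hx]
  exact integrable_finsetSum _ fun j _ => integrable_kernel_mul (hS i j) (hg j) hx

theorem integrable_layerIntegrand
    (hM : ∀ x y, x - y ∈ offPlane → ∀ i j, M x y i j = S i j (x - y))
    (hS : ∀ i j, ContDiffOn ℝ ∞ (S i j) offPlane) (hg : ∀ j, IsTest fun y => g y j)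
    {x : E3} (hx : x ∈ offPlane) :
    Integrable (layerIntegrand M g x) :=
  Integrable.of_eval_piLp (integrable_layerIntegrand_apply hM hS hg hx)

/-- Since `g` vanishes outside `U`, the integral extends to the whole plane and splits into
components. -/
theorem layer_eq
    (hM : ∀ x y, x - y ∈ offPlane → ∀ i j, M x y i j = S i j (x - y))
    (hS : ∀ i j, ContDiffOn ℝ ∞ (S i j) offPlane) (hg : ∀ j, IsTest fun y => g y j)
    (hgU : tsupport g ⊆ U) {x : E3} (hx : x ∈ offPlane) :
    layer U M g x = WithLp.toLp 2 fun i => ∑ j, potential (S i j) (fun y => g y j) x := by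
  have h0 : ∀ y, y ∉ U → layerIntegrand M g x y = 0 := by
    intro y hy
    have : g y = 0 := image_eq_zero_of_notMem_tsupport fun h => hy (hgU h)
    simp [layerIntegrand, this]
  ext i
  rw [layer, setIntegral_eq_integral_of_forall_compl_eq_zero h0,
    eval_integral_piLp (integrable_layerIntegrand_apply hM hS hg hx)]
  simp_rw [layerIntegrand_apply hM hx]
  exact integral_finsetSum _ fun j _ => integrable_kernel_mul (hS i j) (hg j) hx

theorem hasLineDerivAt_layer
    (hM : ∀ x y, x - y ∈ offPlane → ∀ i j, M x y i j = S i j (x - y))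
    (hS : ∀ i j, ContDiffOn ℝ ∞ (S i j) offPlane) (hg : ∀ j, IsTest fun y => g y j)
    (hgU : tsupport g ⊆ U) {x : E3} (hx : x ∈ offPlane) :
    HasLineDerivAt ℝ (layer U M g)
      (WithLp.toLp 2 fun i => ∑ j, potential (pd 2 (S i j)) (fun y => g y j) x) x (stdVec 2) := by
  have h : HasLineDerivAt ℝ
      (fun x => (WithLp.toLp 2 fun i => ∑ j, potential (S i j) (fun y => g y j) x : E3))
      (WithLp.toLp 2 fun i => ∑ j, potential (pd 2 (S i j)) (fun y => g y j) x) x (stdVec 2) := by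
    have := hasDerivAt_pi.2 fun i : Fin 3 => HasDerivAt.fun_sum (u := Finset.univ) fun j _ =>
      hasLineDerivAt_potential (hS i j) (hg j) hx
    exact (PiLp.hasFDerivAt_toLp (𝕜 := ℝ) 2 _).comp_hasDerivAt 0 this
  exact h.congr_of_eventuallyEq <| Filter.eventually_of_mem
    (isOpen_offPlane.mem_nhds hx) fun z hz => layer_eq hM hS hg hgU hz

theorem hasJump_of_potential {v : E3 → E3} {D : Fin 3 → Fin 3 → (E2 → ℝ) → E2 → ℝ}
    (hg : ∀ j, IsTest fun y => g y j)
    (hv : ∀ x ∈ offPlane, v x = WithLp.toLp 2 fun i => ∑ j, potential (S i j) (fun y => g y j) x)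
    (hD : ∀ i j, JumpOp (S i j) (D i j)) {x : E2} {a : E3}
    (ha : ∀ i, a i = ∑ j, D i j (fun y => g y j) x) : HasJump v (toPlane x) a := by
  have h : Tendsto (fun h : ℝ => fun i => ∑ j, (potential (S i j) (fun y => g y j)
      (toPlane x + h • stdVec 2) - potential (S i j) (fun y => g y j) (toPlane x - h • stdVec 2)))
      (𝓝[>] 0) (𝓝 fun i => a i) := by
    refine tendsto_pi_nhds.2 fun i => ?_
    rw [ha i]
    exact tendsto_finsetSum _ fun j _ => hD i j _ (hg j) x
  refine (((PiLp.continuous_toLp 2 _).tendsto _).comp h).congr' ?_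
  filter_upwards [self_mem_nhdsWithin] with t ht
  rw [hv _ (toPlane_add_mem x ht), hv _ (toPlane_sub_mem x ht)]
  ext i
  simp

theorem hasJump_layer
    (hM : ∀ x y, x - y ∈ offPlane → ∀ i j, M x y i j = S i j (x - y))
    (hS : ∀ i j, ContDiffOn ℝ ∞ (S i j) offPlane) (hg : ∀ j, IsTest fun y => g y j)
    (hgU : tsupport g ⊆ U) {D : Fin 3 → Fin 3 → (E2 → ℝ) → E2 → ℝ}
    (hD : ∀ i j, JumpOp (S i j) (D i j)) {x : E2} {a : E3}
    (ha : ∀ i, a i = ∑ j, D i j (fun y => g y j) x) : HasJump (layer U M g) (toPlane x) a :=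
  hasJump_of_potential hg (fun _ hx => layer_eq hM hS hg hgU hx) hD ha

theorem hasJump_pd_layer
    (hM : ∀ x y, x - y ∈ offPlane → ∀ i j, M x y i j = S i j (x - y))
    (hS : ∀ i j, ContDiffOn ℝ ∞ (S i j) offPlane) (hg : ∀ j, IsTest fun y => g y j)
    (hgU : tsupport g ⊆ U) {D : Fin 3 → Fin 3 → (E2 → ℝ) → E2 → ℝ}
    (hD : ∀ i j, JumpOp (pd 2 (S i j)) (D i j)) {x : E2} {a : E3}
    (ha : ∀ i, a i = ∑ j, D i j (fun y => g y j) x) :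
    HasJump (pd 2 (layer U M g)) (toPlane x) a :=
  hasJump_of_potential hg (fun _ hx => (hasLineDerivAt_layer hM hS hg hgU hx).lineDeriv) hD ha

end Layer

theorem pd_apply {g : E2 → E3} {x : E2} (hg : DifferentiableAt ℝ g x) (a : Fin 2) (i : Fin 3) :
    pd a g x i = pd a (fun z => g z i) x := by
  have h := (hg.lineDifferentiableAt (v := stdVec a)).hasLineDerivAt
  exact (((EuclideanSpace.proj (𝕜 := ℝ) i).hasFDerivAt.comp_hasDerivAt (0 : ℝ) h).deriv).symm

theorem isTest_apply {g : E2 → E3} (hg : ContDiff ℝ ∞ g) (hgc : HasCompactSupport g) (j : Fin 3) :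
    IsTest fun y => g y j where
  smooth := contDiff_euclidean.1 hg j
  compact := hgc.comp_left (g := fun v : E3 => v j) rfl

theorem jumpOp_pd_stressKernel (lam mu : ℝ) (L : List (Fin 3)) (l i j a : Fin 3) :
    JumpOp (pd a (stressKernel lam mu L l i j)) (stressJump lam mu (a :: L) l i j) :=
  (jumpOp_stressKernel lam mu (a :: L) l i j).congr (eqOn_pd_stressKernel lam mu L l i j a)

theorem jumpOp_pd_neg_stressKernel (lam mu : ℝ) (L : List (Fin 3)) (l i j a : Fin 3) :
    JumpOp (pd a fun d => -1 * stressKernel lam mu L l i j d)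
      (fun f x => -1 * stressJump lam mu (a :: L) l i j f x) :=
  ((jumpOp_stressKernel lam mu (a :: L) l i j).const_mul (-1)).congr fun d hd => by
    rw [pd_const_mul _ (differentiableAt_of_contDiffOn isOpen_offPlane
      (contDiffOn_stressKernel lam mu L l i j) hd), eqOn_pd_stressKernel lam mu L l i j a hd]

end

end ElasticJump

/-! ### The jump relations -/

open ElasticJump
theorem mainTheorem3 (lam mu : ℝ) (hlam : 0 < lam) (hmu : 0 < mu)
    (U : Set E2) (hU : IsOpen U)
    (g : E2 → E3) (hg : ContDiff ℝ ∞ g) (hgc : HasCompactSupport g) (hgU : tsupport g ⊆ U) :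
    -- off the plane the integrals converge, and the normal derivatives below exist
    (∀ x : E3, x 2 ≠ 0 →
      IntegrableOn (layerIntegrand (fun x y => G lam mu x y (stdVec 2)) g x) U ∧
      IntegrableOn (layerIntegrand (fun x y => dyG lam mu 0 x y (stdVec 2)) g x) U ∧
      IntegrableOn (layerIntegrand (fun x y => G lam mu x y (stdVec 0)) g x) U ∧
      IntegrableOn (layerIntegrand (fun x y => dyG lam mu 2 x y (stdVec 2)) g x) U ∧
      LineDifferentiableAt ℝ (layer U (fun x y => G lam mu x y (stdVec 2)) g) x (stdVec 2) ∧
      LineDifferentiableAt ℝ (layer U (fun x y => dyG lam mu 2 x y (stdVec 2)) g) x (stdVec 2) ∧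
      LineDifferentiableAt ℝ (layer U (fun x y => G lam mu x y (stdVec 0)) g) x (stdVec 2)) ∧
    ∀ x ∈ U,
      HasJump (layer U (fun x y => G lam mu x y (stdVec 2)) g) (toPlane x) (g x) ∧
      HasJump (layer U (fun x y => dyG lam mu 0 x y (stdVec 2)) g) (toPlane x) (-pd 0 g x) ∧
      HasJump (layer U (fun x y => G lam mu x y (stdVec 0)) g) (toPlane x)
        ((lam / (lam + 2 * mu) * g x 0) • stdVec 2 + g x 2 • stdVec 0) ∧
      HasJump (layer U (fun x y => dyG lam mu 2 x y (stdVec 2)) g) (toPlane x)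
        ((lam / (lam + 2 * mu) * surfDiv g x) • stdVec 2 + surfGrad (fun z => g z 2) x) ∧
      HasJump (pd 2 (layer U (fun x y => G lam mu x y (stdVec 2)) g)) (toPlane x)
        (-((lam / (lam + 2 * mu) * surfDiv g x) • stdVec 2) - surfGrad (fun z => g z 2) x) ∧
      HasJump (pd 2 (layer U (fun x y => dyG lam mu 2 x y (stdVec 2)) g)) (toPlane x)
        (((3 * lam + 4 * mu) / (lam + 2 * mu) * pd 0 (pd 0 fun z => g z 0) x
            + pd 1 (pd 1 fun z => g z 0) x
            + 2 * ((lam + mu) / (lam + 2 * mu)) * pd 0 (pd 1 fun z => g z 1) x) • stdVec 0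
          + ((3 * lam + 4 * mu) / (lam + 2 * mu) * pd 1 (pd 1 fun z => g z 1) x
            + pd 0 (pd 0 fun z => g z 1) x
            + 2 * ((lam + mu) / (lam + 2 * mu)) * pd 0 (pd 1 fun z => g z 0) x) • stdVec 1
          - (lam / (lam + 2 * mu) * (pd 0 (pd 0 fun z => g z 2) x
            + pd 1 (pd 1 fun z => g z 2) x)) • stdVec 2) ∧
      HasJump (pd 2 (layer U (fun x y => G lam mu x y (stdVec 0)) g)) (toPlane x)
        (((3 * lam + 4 * mu) / (lam + 2 * mu) * pd 0 (fun z => g z 0) x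
            + pd 1 (fun z => g z 1) x) • stdVec 0
          + (lam / (lam + 2 * mu) * pd 1 (fun z => g z 0) x + pd 0 (fun z => g z 1) x) • stdVec 1
          - (lam / (lam + 2 * mu) * pd 0 (fun z => g z 2) x) • stdVec 2) := by
  have hp := Real.pi_pos
  have h2 : lam + 2 * mu ≠ 0 := by positivity
  have ht := isTest_apply hg hgc
  have hG := fun l x y (h : x - y ∈ offPlane) i j => G_stdVec hlam hmu l i j h
  have hdG := fun k x y (h : x - y ∈ offPlane) i j => dyG_stdVec hlam hmu k 2 i j h
  have sG := fun l i j => contDiffOn_stressKernel lam mu [] l i j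
  have sdG := fun k i j => contDiffOn_const (c := (-1 : ℝ)).mul
    (contDiffOn_stressKernel lam mu [k] 2 i j)
  have jG := fun l i j => jumpOp_stressKernel lam mu [] l i j
  have jdG := fun k i j => (jumpOp_stressKernel lam mu [k] 2 i j).const_mul (-1)
  refine ⟨fun x hx => ⟨(integrable_layerIntegrand (hG 2) (sG 2) ht hx).integrableOn,
    (integrable_layerIntegrand (hdG 0) (sdG 0) ht hx).integrableOn,
    (integrable_layerIntegrand (hG 0) (sG 0) ht hx).integrableOn,
    (integrable_layerIntegrand (hdG 2) (sdG 2) ht hx).integrableOn,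
    (hasLineDerivAt_layer (hG 2) (sG 2) ht hgU hx).lineDifferentiableAt,
    (hasLineDerivAt_layer (hdG 2) (sdG 2) ht hgU hx).lineDifferentiableAt,
    (hasLineDerivAt_layer (hG 0) (sG 0) ht hgU hx).lineDifferentiableAt⟩, fun x _ => ?_⟩
  -- Mixed derivatives get one normal form, so that `ring` can identify them.
  have hc : ∀ j, pd 1 (pd 0 fun z => g z j) x = pd 0 (pd 1 fun z => g z j) x := fun j =>
    eqOn_pd_comm isOpen_univ (ht j).smooth.contDiffOn 1 0 (Set.mem_univ x)
  have hgd : DifferentiableAt ℝ g x := hg.differentiable (by simp) x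
  refine ⟨hasJump_layer (hG 2) (sG 2) ht hgU (jG 2) ?_,
    hasJump_layer (hdG 0) (sdG 0) ht hgU (jdG 0) ?_,
    hasJump_layer (hG 0) (sG 0) ht hgU (jG 0) ?_,
    hasJump_layer (hdG 2) (sdG 2) ht hgU (jdG 2) ?_,
    hasJump_pd_layer (hG 2) (sG 2) ht hgU
      (fun i j => jumpOp_pd_stressKernel lam mu [] 2 i j 2) ?_,
    hasJump_pd_layer (hdG 2) (sdG 2) ht hgU
      (fun i j => jumpOp_pd_neg_stressKernel lam mu [2] 2 i j 2) ?_,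
    hasJump_pd_layer (hG 0) (sG 0) ht hgU
      (fun i j => jumpOp_pd_stressKernel lam mu [] 0 i j 2) ?_⟩
  -- Counting normal indices selects the branch of each jump recursion; a rational identity in `λ`,
  -- `μ`, `π` and derivatives of `g` remains in each component.
  all_goals
    intro i
    fin_cases i <;>
    simp [Fin.sum_univ_three, stressJump, delta, newtonJump, bihJump, tangential, stdVec,
      surfDiv, surfGrad, List.count_cons, hc, pd_apply hgd] <;>
    field_simp <;> ring
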